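/- Let $\ell\ge 0$ and let $m_1,\dots,m_\ell\ge 1$ be integers such that $1,m_1,\dots,m_\ell$ are distinct; put $m_0=1$. Consider the system $s(1,m_1,\dots,m_\ell)$: $\dot x=\sum_{i=0}^{\ell}P_{m_i}(x,y)$, $\dot y=\sum_{i=0}^{\ell}Q_{m_i}(x,y)$, where $P_{m_i},Q_{m_i}$ are homogeneous of degree $m_i$ with indeterminate real coefficients (written with binomial factors), and $P_1=cx+dy$, $Q_1=ex+fy$. Let $S$ be the algebra of its unimodular comitants, that is, of the real polynomials in the coefficients of the system and in $x,y$ that are invariant under $SL(2,\mathbb R)$. A comitant has type $(\delta,d_0,\dots,d_\ell)$ if it is homogeneous of degree $\delta$ in $x,y$ and of degree $d_i$ in the coefficients of $P_{m_i},Q_{m_i}$; its semi-invariant is then the coefficient of $x^\delta$. The Krull dimension $\varrho(A)$ of an algebra $A$ is the maximal number of its algebraically independent elements. Let $k_2=-ex^2+(c-f)xy+dy^2$, and consider the identity $$\dot x\,\frac{\partial U}{\partial x}+\dot y\,\frac{\partial U}{\partial y}=\sum_{k\ge 1}G_k\,k_2^{k+1},\qquad U=k_2+\sum_{r\ge 3}F_r(x,y),$$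 with unknown $G_1,G_2,\dots$ and unknown coefficients of the homogeneous polynomials $F_r$ of degree $r$. For $k\ge1$, the equations for the monomials of degrees $3,\dots,2k+2$ form a linear system for $G_1,\dots,G_k$ and the coefficients of $F_3,\dots,F_{2k+2}$. Choosing one coefficient in each of $F_4,F_6,\dots,F_{2k+2}$ as a free parameter makes it square, and Cramer's rule expresses $G_k$ as a fraction whose numerator is $G_{k,i_1,\dots,i_k}+B_{k,i_1,\dots,i_k}b_{i_1}+\dots+Z_{k,i_1,\dots,i_k}z_{i_k}$, where $b_{i_1},\dots,z_{i_k}$ are the free parameters. The comitants associated to $G_k$ are the sums of comitants of types $(2(k+1),d_0,\dots,d_\ell)$ with $\sum_i d_i=\frac12(5k^2+13k+2)$ and weight $\frac12\bigl(\sum_i d_i(m_i-1)-2(k+1)\bigr)=-1$ that have such a numerator, for some choice of the free parameters and some values of them in the field of rational functions of the coefficients of the system, as semi-invariant. The generalized focal pseudo-quantities are $G_0=i_1=c+f$ and the semi-invariants of the comitants associated to $G_k$, $k\ge 1$. Let $S'$ be the algebra generated by the space of comitants of type $(0,1,0,\dots,0)$ and by all spaces of comitants of the types just listed, $k\ge 1$.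 Then $S'\subseteq S$, the Krull dimension of $S$ is $$\varrho(S)=2\Bigl(\sum_{i=1}^{\ell}m_i+\ell\Bigr)+3,$$ and the maximal number of algebraically independent generalized focal pseudo-quantities does not exceed this number. -/

import Mathlib

noncomputable section

namespace FocalPseudo

open MvPolynomial

/-- The degrees `1, m₁, …, m_ℓ` of the homogeneous parts of the system `s(1, m₁, …, m_ℓ)`. -/
def degs {ℓ : ℕ} (m : Fin ℓ → ℕ) : Fin (ℓ + 1) → ℕ := Fin.cons 1 m

/-- The coefficients of `s(1, m₁, …, m_ℓ)`: `⟨i, 0, j⟩` is the `j`-th coefficient of the `i`-th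
homogeneous part of the right-hand side of `dx/dt`, and `⟨i, 1, j⟩` the one for `dy/dt`. -/
abbrev Coef {ℓ : ℕ} (m : Fin ℓ → ℕ) : Type := Σ i : Fin (ℓ + 1), Fin 2 × Fin (degs m i + 1)

/-- The ring of real polynomials in the coefficients of the system. -/
abbrev CoefRing {ℓ : ℕ} (m : Fin ℓ → ℕ) : Type := MvPolynomial (Coef m) ℝ

/-- The ring of real polynomials in the coefficients of the system and in the phase variables
`x` (that is `inr 0`) and `y` (that is `inr 1`). -/
abbrev FullRing {ℓ : ℕ} (m : Fin ℓ → ℕ) : Type := MvPolynomial (Coef m ⊕ Fin 2) ℝ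

/-- The binary form `∑ⱼ (n choose j) aⱼ x^(n-j) y^j` of degree `n`. -/
def binaryForm {R : Type*} [CommSemiring R] {n : ℕ} (a : Fin (n + 1) → R) (x y : R) : R :=
  ∑ j : Fin (n + 1), (n.choose j : R) * a j * x ^ (n - (j : ℕ)) * y ^ (j : ℕ)

/-! ### Comitants -/

/-- The `i`-th homogeneous part `(P_{m_i}(v), Q_{m_i}(v))` of the right-hand side of the system
with real coefficients `a`, at the point `v` of the plane. -/
def part {ℓ : ℕ} (m : Fin ℓ → ℕ) (a : Coef m → ℝ) (i : Fin (ℓ + 1)) (v : Fin 2 → ℝ) :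
    Fin 2 → ℝ :=
  fun ε => binaryForm (fun j => a ⟨i, ε, j⟩) (v 0) (v 1)

/-- The linear substitution `v ↦ q v` carries the system with coefficients `a` to the system with
coefficients `b`. (For given `q` and `a` there is exactly one such `b`.) -/
def Carries {ℓ : ℕ} (m : Fin ℓ → ℕ) (q : Matrix.SpecialLinearGroup (Fin 2) ℝ)
    (a b : Coef m → ℝ) : Prop :=
  ∀ (i : Fin (ℓ + 1)) (v : Fin 2 → ℝ),
    part m b i (q.1.mulVec v) = q.1.mulVec (part m a i v)

/-- `f` is a unimodular comitant: a polynomial in the coefficients and the phase variables that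
is invariant under `SL(2, ℝ)`. -/
def IsComitant {ℓ : ℕ} (m : Fin ℓ → ℕ) (f : FullRing m) : Prop :=
  ∀ (q : Matrix.SpecialLinearGroup (Fin 2) ℝ) (a b : Coef m → ℝ), Carries m q a b →
    ∀ v : Fin 2 → ℝ, eval (Sum.elim b (q.1.mulVec v)) f = eval (Sum.elim a v) f

/-- The Sibirsky algebra `S_{1, m₁, …, m_ℓ}` of unimodular comitants. -/
def comitants {ℓ : ℕ} (m : Fin ℓ → ℕ) : Subalgebra ℝ (FullRing m) where
  carrier := {f | IsComitant m f}
  mul_mem' := by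
    intro f g hf hg q a b h v
    rw [map_mul, map_mul, hf q a b h v, hg q a b h v]
  add_mem' := by
    intro f g hf hg q a b h v
    rw [map_add, map_add, hf q a b h v, hg q a b h v]
  algebraMap_mem' := by
    intro r q a b _ v
    simp [MvPolynomial.algebraMap_eq]

/-- The multidegree of the variables: first the degree in `x, y`, then, for each `i`, the degree
in the coefficients of the `i`-th homogeneous part. -/
def multiWeight {ℓ : ℕ} (m : Fin ℓ → ℕ) : Coef m ⊕ Fin 2 → ℕ × (Fin (ℓ + 1) → ℕ) :=
  Sum.elim (fun c => (0, Pi.single c.1 1)) (fun _ => (1, 0))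

/-- The space `S^{(δ, d₀, …, d_ℓ)}` of the unimodular comitants of type `(δ, d₀, …, d_ℓ)`. -/
def comitantsOfType {ℓ : ℕ} (m : Fin ℓ → ℕ) (δ : ℕ) (d : Fin (ℓ + 1) → ℕ) :
    Submodule ℝ (FullRing m) :=
  Subalgebra.toSubmodule (comitants m) ⊓
    weightedHomogeneousSubmodule ℝ (multiWeight m) (δ, d)

/-- The value at `(x, y) = (1, 0)`. For a comitant of degree `δ` in `x, y` this is the
coefficient of `x^δ`, the semi-invariant of the comitant. -/
def semiInvariant {ℓ : ℕ} (m : Fin ℓ → ℕ) : FullRing m →ₐ[ℝ] CoefRing m :=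
  aeval (Sum.elim X ![1, 0])

/-! ### The identity that defines the quantities `G_k` -/

/-- The right-hand side of `dx/dt` (`ε = 0`) or `dy/dt` (`ε = 1`), as a polynomial in `x, y`
whose coefficients are the indeterminate coefficients of the system. -/
def field {ℓ : ℕ} (m : Fin ℓ → ℕ) (ε : Fin 2) : MvPolynomial (Fin 2) (CoefRing m) :=
  ∑ i : Fin (ℓ + 1),
    binaryForm (fun j : Fin (degs m i + 1) => C (X (⟨i, ε, j⟩ : Coef m))) (X 0) (X 1)

/-- The derivative `(dx/dt) ∂U/∂x + (dy/dt) ∂U/∂y` of `U` along the system. -/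
def lieDeriv {ℓ : ℕ} (m : Fin ℓ → ℕ) (U : MvPolynomial (Fin 2) (CoefRing m)) :
    MvPolynomial (Fin 2) (CoefRing m) :=
  field m 0 * pderiv 0 U + field m 1 * pderiv 1 U

/-- The coefficients of the linear part `dx/dt = c x + d y + …`, `dy/dt = e x + f y + …`:
`c`, `d`, `e`, `f` are `lin m 0 0`, `lin m 0 1`, `lin m 1 0`, `lin m 1 1`. -/
def lin {ℓ : ℕ} (m : Fin ℓ → ℕ) (ε j : Fin 2) : CoefRing m :=
  X (⟨0, ε, (j : Fin (1 + 1))⟩ : Coef m)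

/-- `i₁ = c + f`, the null focal pseudo-quantity `G₀`. -/
def i1 {ℓ : ℕ} (m : Fin ℓ → ℕ) : CoefRing m := lin m 0 0 + lin m 1 1

/-- `k₂ = -e x² + (c - f) x y + d y²`. -/
def k2 {ℓ : ℕ} (m : Fin ℓ → ℕ) : MvPolynomial (Fin 2) (CoefRing m) :=
  -C (lin m 1 0) * X 0 ^ 2 + C (lin m 0 0 - lin m 1 1) * (X 0 * X 1) + C (lin m 0 1) * X 1 ^ 2

/-- The monomials `x^(r-p) y^p` with `3 ≤ r ≤ 2k + 2`; the index `⟨s, p⟩` stands for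
`r = s + 3`. They number both the equations obtained by comparing coefficients in
`dU/dt = ∑ⱼ Gⱼ k₂^(j+1)`, `U = k₂ + F₃ + F₄ + …`, up to the degree `2k + 2` in which `G_k` first
occurs, and the unknown coefficients of `F₃, …, F_{2k+2}`. -/
abbrev Idx (k : ℕ) : Type := Σ s : Fin (2 * k), Fin ((s : ℕ) + 3 + 1)

/-- The degree `r` of the monomial `x^(r-p) y^p`. -/
def Idx.deg {k : ℕ} (ρ : Idx k) : ℕ := (ρ.1 : ℕ) + 3

/-- The exponents of the monomial `x^(r-p) y^p`. -/
def Idx.expo {k : ℕ} (ρ : Idx k) : Fin 2 →₀ ℕ :=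
  Finsupp.single 0 (ρ.deg - (ρ.2 : ℕ)) + Finsupp.single 1 (ρ.2 : ℕ)

/-- The coefficients, in the equations of degree `3, …, 2k + 2`, of a polynomial in `x, y`. -/
def coeffVec {ℓ : ℕ} (m : Fin ℓ → ℕ) (k : ℕ) (U : MvPolynomial (Fin 2) (CoefRing m)) :
    Idx k → CoefRing m :=
  fun ρ => coeff ρ.expo U

/-- What the unknown `a` at the term `(r choose p) a x^(r-p) y^p` of `F_r` is multiplied by
in the left-hand side `dU/dt` of the identity. -/
def unknownTerm {ℓ : ℕ} (m : Fin ℓ → ℕ) {k : ℕ} (τ : Idx k) :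
    MvPolynomial (Fin 2) (CoefRing m) :=
  lieDeriv m (monomial τ.expo ((τ.deg.choose (τ.2 : ℕ) : ℕ) : CoefRing m))

/-- A choice of the free unknowns: for each `j = 1, …, k` (numbered from `0`), one coefficient of
the form `F_{2j+2}`. -/
abbrev Choice (k : ℕ) : Type := (j : Fin k) → Fin (2 * (j : ℕ) + 1 + 3 + 1)

/-- The index of the `j`-th free unknown. -/
def free {k : ℕ} (ι : Choice k) (j : Fin k) : Idx k :=
  ⟨⟨2 * (j : ℕ) + 1, by omega⟩, ι j⟩

open Classical in
/-- The square matrix of the linear system for `G₁, …, G_k` and those coefficients of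
`F₃, …, F_{2k+2}` that are not free. The column of the free coefficient of `F_{2j+2}` is occupied
by the column of `G_j`, in which `-k₂^(j+1)` stands. -/
def systemMatrix {ℓ : ℕ} (m : Fin ℓ → ℕ) {k : ℕ} (ι : Choice k) :
    Matrix (Idx k) (Idx k) (CoefRing m) :=
  Matrix.of fun ρ τ =>
    coeffVec m k (if ∃ j, τ = free ι j then -(k2 m ^ (τ.deg / 2)) else unknownTerm m τ) ρ

/-- The numerator `G_{k,ι} + B_{k,ι} b₁ + ⋯ + Z_{k,ι} b_k` of the fraction that Cramer's rule gives
for `G_k`, when the free unknowns are given the values `b₁, …, b_k`, which may be rational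
functions of the coefficients of the system. The denominator is `(systemMatrix m ι).det`. -/
def numerator {ℓ : ℕ} (m : Fin ℓ → ℕ) {k : ℕ} (hk : 1 ≤ k) (ι : Choice k)
    (b : Fin k → FractionRing (CoefRing m)) : FractionRing (CoefRing m) :=
  algebraMap (CoefRing m) (FractionRing (CoefRing m))
      ((systemMatrix m ι).cramer (coeffVec m k (-lieDeriv m (k2 m)))
        (free ι ⟨k - 1, by omega⟩)) +
    ∑ j : Fin k, algebraMap (CoefRing m) (FractionRing (CoefRing m))
      ((systemMatrix m ι).cramer (coeffVec m k (-unknownTerm m (free ι j)))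
        (free ι ⟨k - 1, by omega⟩)) * b j

/-! ### Generalized focal pseudo-quantities -/

/-- The types `(2(k+1), d₀, …, d_ℓ)` that belong to `G_k`: the total degree in the coefficients
is the degree `(5k² + 13k + 2)/2` of the numerators of `G_k`, and the weight
`(∑ dᵢ (mᵢ - 1) - 2(k+1)) / 2` is `-1`. -/
def IsTypeOf {ℓ : ℕ} (m : Fin ℓ → ℕ) (k : ℕ) (d : Fin (ℓ + 1) → ℕ) : Prop :=
  2 * ∑ i, d i = 5 * k ^ 2 + 13 * k + 2 ∧
    ∑ i, (d i : ℤ) * ((degs m i : ℤ) - 1) - 2 * ((k : ℤ) + 1) = 2 * (-1)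

/-- The comitants with the degrees that belong to `G_k`: the sums of comitants of these types. -/
def comitantsFor {ℓ : ℕ} (m : Fin ℓ → ℕ) (k : ℕ) : Submodule ℝ (FullRing m) :=
  ⨆ d : {d : Fin (ℓ + 1) → ℕ // IsTypeOf m k d}, comitantsOfType m (2 * (k + 1)) d.1

/-- Generalized focal pseudo-quantities: the null one `G₀ = i₁`, and, for `k ≥ 1`, the numerators
of `G_k` that are semi-invariants of comitants with the degrees that belong to `G_k`. -/
def IsPseudoQuantity {ℓ : ℕ} (m : Fin ℓ → ℕ) (S : CoefRing m) : Prop :=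
  S = i1 m ∨
    ∃ (k : ℕ) (hk : 1 ≤ k) (ι : Choice k) (b : Fin k → FractionRing (CoefRing m)),
      algebraMap (CoefRing m) (FractionRing (CoefRing m)) S = numerator m hk ι b ∧
        ∃ f ∈ comitantsFor m k, S = semiInvariant m f

/-- The algebra `S'` generated by the space of type `(0, 1, 0, …, 0)`, to which `G₀` belongs, and
by the spaces of the types that belong to `G₁, G₂, …`. -/
def comitants' {ℓ : ℕ} (m : Fin ℓ → ℕ) : Subalgebra ℝ (FullRing m) :=
  Algebra.adjoin ℝ
    ((comitantsOfType m 0 (Pi.single 0 1) : Set (FullRing m)) ∪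
      ⋃ (k : ℕ) (_ : 1 ≤ k), (comitantsFor m k : Set (FullRing m)))

end FocalPseudo

end

noncomputable section

namespace FocalPseudo

open MvPolynomial

/-! ### Binary forms -/

/-! The dimension count is a moving-frame argument. Let `v` be the phase vector and `w` its image
under the linear part. Where `det (v, w) ≠ 0`, some element of `SL(2, ℝ)` carries `v` to `(1, 0)`
and `w` to a multiple of `(0, 1)`, so the orbit meets the section `c = 0`, `(x, y) = (1, 0)`. A
comitant is therefore determined by its restriction to the section (`restrict_injective`), and the
transcendence degree is at most the number of coefficients other than `c`.

Conversely, the coordinates of the system in the frame `v, w`, cleared of denominators, are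
comitants. On the section each becomes one coefficient times a nonzero constant and a power of `e`,
so they are algebraically independent (`algebraicIndependent_frameComitant`).

Pseudo-quantities are values at `(1, 0)` of comitants. This evaluation is an algebra homomorphism,
so independent pseudo-quantities come from equally many independent comitants. -/

lemma map_binaryForm {R A : Type*} [CommSemiring R] [CommSemiring A] (g : R →+* A) {n : ℕ}
    (a : Fin (n + 1) → R) (x y : R) :
    g (binaryForm a x y) = binaryForm (fun j => g (a j)) (g x) (g y) := by
  simp [binaryForm]

lemma binaryForm_one_zero {R : Type*} [CommSemiring R] {n : ℕ} (a : Fin (n + 1) → R) :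
    binaryForm a 1 0 = a 0 := by
  unfold binaryForm
  rw [Finset.sum_eq_single 0]
  · simp
  · intro j _ hj
    have : (j : ℕ) ≠ 0 := fun h => hj (Fin.ext h)
    simp [this]
  · simp

lemma exists_binaryForm_of_isHomogeneous {K : Type*} [Field K] [CharZero K] {n : ℕ}
    {p : MvPolynomial (Fin 2) K} (hp : p.IsHomogeneous n) :
    ∃ b : Fin (n + 1) → K, ∀ x y : K, eval ![x, y] p = binaryForm b x y := by
  -- Homogeneity leaves at most one exponent `d` with `d 1 = j`; characteristic zero allows division
  -- by the binomial factor.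
  refine ⟨fun j => (∑ d ∈ p.support with d 1 = (j : ℕ), coeff d p) / (n.choose j : K), fun x y => ?_⟩
  have hdeg : ∀ d ∈ p.support, d 0 + d 1 = n := by
    intro d hd
    have := hp (mem_support_iff.mp hd)
    simpa [Finsupp.weight_apply, Finsupp.sum_fintype] using this
  rw [eval_eq', ← Finset.sum_fiberwise_of_maps_to (s := p.support) (t := Finset.range (n + 1))
    (g := fun d => d 1) (fun d hd => by have := hdeg d hd; simp; omega), Finset.sum_range,
    binaryForm]
  refine Finset.sum_congr rfl fun j _ => ?_
  have hc : (n.choose j : K) ≠ 0 :=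
    Nat.cast_ne_zero.mpr (Nat.choose_pos (Nat.lt_succ_iff.mp j.2)).ne'
  rw [mul_div_cancel₀ _ hc, Finset.sum_mul, Finset.sum_mul]
  refine Finset.sum_congr rfl fun d hd => ?_
  obtain ⟨hd, hj⟩ := Finset.mem_filter.mp hd
  have h0 : d 0 = n - j := by have := hdeg d hd; omega
  simp [h0, hj, mul_assoc]

lemma isHomogeneous_binaryForm {σ R : Type*} [CommSemiring R] {n : ℕ} (a : Fin (n + 1) → R)
    {x y : MvPolynomial σ R} (hx : x.IsHomogeneous 1) (hy : y.IsHomogeneous 1) :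
    (binaryForm (fun j => C (a j)) x y).IsHomogeneous n := by
  refine IsHomogeneous.sum _ _ _ fun j _ => ?_
  have h := (((isHomogeneous_C σ ((n.choose j : R) * a j)).mul (hx.pow (n - j))).mul
    (hy.pow (j : ℕ)))
  have hn : 0 + 1 * (n - (j : ℕ)) + 1 * (j : ℕ) = n := by omega
  rw [hn] at h
  simpa using h

lemma isHomogeneous_linear {R : Type*} [CommSemiring R] (r s : R) :
    (C r * X 0 + C s * X 1 : MvPolynomial (Fin 2) R).IsHomogeneous 1 :=
  ((isHomogeneous_X R 0).C_mul r).add ((isHomogeneous_X R 1).C_mul s)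

/-! ### Linear substitutions -/

/-- The transformed parts are `q ∘ F ∘ q⁻¹`, again forms of the same degree, hence given by
coefficients `b`. -/
lemma exists_carries {ℓ : ℕ} (m : Fin ℓ → ℕ) (q : Matrix.SpecialLinearGroup (Fin 2) ℝ)
    (a : Coef m → ℝ) : ∃ b, Carries m q a b := by
  have key : ∀ (i : Fin (ℓ + 1)) (ε : Fin 2), ∃ b : Fin (degs m i + 1) → ℝ, ∀ u : Fin 2 → ℝ,
      binaryForm b (u 0) (u 1) = q.1.mulVec (part m a i ((q⁻¹).1.mulVec u)) ε := by
    intro i ε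
    let L : Fin 2 → MvPolynomial (Fin 2) ℝ :=
      fun η => C ((q⁻¹).1 η 0) * X 0 + C ((q⁻¹).1 η 1) * X 1
    have hF : ∀ η : Fin 2, (binaryForm (fun j => C (a ⟨i, η, j⟩)) (L 0) (L 1)).IsHomogeneous
        (degs m i) := fun η =>
      isHomogeneous_binaryForm _ (isHomogeneous_linear _ _) (isHomogeneous_linear _ _)
    obtain ⟨b, hb⟩ := exists_binaryForm_of_isHomogeneous
      (((hF 0).C_mul (q.1 ε 0)).add ((hF 1).C_mul (q.1 ε 1)))
    refine ⟨b, fun u => ?_⟩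
    rw [← hb]
    simp [map_binaryForm, L, part, Matrix.mulVec, dotProduct, Fin.sum_univ_two]
  choose b hb using key
  refine ⟨fun s => b s.1 s.2.1 s.2.2, fun i v => funext fun ε => ?_⟩
  have := hb i ε (q.1.mulVec v)
  rw [Matrix.mulVec_mulVec, ← Matrix.SpecialLinearGroup.coe_mul, inv_mul_cancel,
    Matrix.SpecialLinearGroup.coe_one, Matrix.one_mulVec] at this
  exact this

lemma exists_specialLinearGroup_mulVec {K : Type*} [Field K] (v w : Fin 2 → K)
    (h : v 0 * w 1 - v 1 * w 0 ≠ 0) :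
    ∃ q : Matrix.SpecialLinearGroup (Fin 2) K,
      q.1.mulVec v = ![1, 0] ∧ q.1.mulVec w = ![0, v 0 * w 1 - v 1 * w 0] := by
  set k := v 0 * w 1 - v 1 * w 0 with hk
  -- The inverse of the matrix with columns `v` and `w / k`, which has determinant 1.
  refine ⟨⟨!![w 1 / k, -(w 0) / k; -(v 1), v 0], ?_⟩, ?_, ?_⟩
  · rw [Matrix.det_fin_two_of]
    field_simp
    rw [hk]; ring
  · ext ε
    fin_cases ε
    · simp [Matrix.mulVec, dotProduct, Fin.sum_univ_two]
      field_simp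
      rw [hk]; ring
    · simp [Matrix.mulVec, dotProduct, Fin.sum_univ_two]
      ring
  · ext ε
    fin_cases ε
    · simp [Matrix.mulVec, dotProduct, Fin.sum_univ_two]
      field_simp
      ring
    · simp [Matrix.mulVec, dotProduct, Fin.sum_univ_two, hk]
      ring

/-! ### The coordinates of a vector form in a moving frame -/

/-- The restriction of a binary form to the line `t ↦ v + t w`. -/
def onLine {R : Type*} [CommRing R] {n : ℕ} (a : Fin (n + 1) → R) (v w : Fin 2 → R) :
    Polynomial R :=
  binaryForm (fun j => Polynomial.C (a j))
    (Polynomial.C (v 0) + Polynomial.C (w 0) * Polynomial.X)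
    (Polynomial.C (v 1) + Polynomial.C (w 1) * Polynomial.X)

/-- The coordinates, multiplied by `det (v, w)`, of the vector form with coefficients `a` with
respect to the frame `v, w`, along the line `t ↦ v + t w`. -/
def frameCoord {R : Type*} [CommRing R] {n : ℕ} (a : Fin 2 → Fin (n + 1) → R)
    (v w : Fin 2 → R) : Fin 2 → Polynomial R :=
  ![Polynomial.C (w 1) * onLine (a 0) v w - Polynomial.C (w 0) * onLine (a 1) v w,
    Polynomial.C (v 0) * onLine (a 1) v w - Polynomial.C (v 1) * onLine (a 0) v w]

lemma map_onLine {R A : Type*} [CommRing R] [CommRing A] (g : R →+* A) {n : ℕ}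
    (a : Fin (n + 1) → R) (v w : Fin 2 → R) :
    (onLine a v w).map g = onLine (fun j => g (a j)) (fun ε => g (v ε)) (fun ε => g (w ε)) := by
  have := map_binaryForm (Polynomial.mapRingHom g) (fun j => Polynomial.C (a j))
    (Polynomial.C (v 0) + Polynomial.C (w 0) * Polynomial.X)
    (Polynomial.C (v 1) + Polynomial.C (w 1) * Polynomial.X)
  simpa [onLine] using this

lemma map_frameCoord {R A : Type*} [CommRing R] [CommRing A] (g : R →+* A) {n : ℕ}
    (a : Fin 2 → Fin (n + 1) → R) (v w : Fin 2 → R) (ε : Fin 2) :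
    (frameCoord a v w ε).map g =
      frameCoord (fun η j => g (a η j)) (fun η => g (v η)) (fun η => g (w η)) ε := by
  fin_cases ε <;> simp [frameCoord, map_onLine]

lemma eval_onLine {R : Type*} [CommRing R] {n : ℕ} (a : Fin (n + 1) → R) (v w : Fin 2 → R)
    (t : R) : (onLine a v w).eval t = binaryForm a (v 0 + w 0 * t) (v 1 + w 1 * t) := by
  have := map_binaryForm (Polynomial.evalRingHom t) (fun j => Polynomial.C (a j))
    (Polynomial.C (v 0) + Polynomial.C (w 0) * Polynomial.X)
    (Polynomial.C (v 1) + Polynomial.C (w 1) * Polynomial.X)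
  simpa [onLine] using this

lemma coeff_onLine_axes {R : Type*} [CommRing R] {n : ℕ} (a : Fin (n + 1) → R) (e : R)
    (j : Fin (n + 1)) :
    (onLine a ![1, 0] ![0, e]).coeff j = (n.choose j : R) * a j * e ^ (j : ℕ) := by
  have h : onLine a ![1, 0] ![0, e] = ∑ i : Fin (n + 1),
      Polynomial.monomial (i : ℕ) ((n.choose i : R) * a i * e ^ (i : ℕ)) := by
    unfold onLine binaryForm
    refine Finset.sum_congr rfl fun i _ => ?_
    rw [← Polynomial.C_mul_X_pow_eq_monomial]
    simp [mul_pow, mul_assoc]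
  rw [h, Polynomial.finsetSum_coeff, Finset.sum_eq_single j]
  · simp
  · intro i _ hij
    rw [Polynomial.coeff_monomial, if_neg fun h => hij (Fin.ext h)]
  · simp

/-- The line is `(1, e t)`, which gives `e ^ j`. The frame determinant `e` adds one more factor in
the first coordinate only, since the second axis vector is `(0, e)` and the first is `(1, 0)`. -/
lemma coeff_frameCoord_axes {R : Type*} [CommRing R] {n : ℕ} (a : Fin 2 → Fin (n + 1) → R)
    (e : R) (ε : Fin 2) (j : Fin (n + 1)) :
    (frameCoord a ![1, 0] ![0, e] ε).coeff j =
      (n.choose j : R) * e ^ ((j : ℕ) + (1 - (ε : ℕ))) * a ε j := by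
  fin_cases ε <;> simp [frameCoord, coeff_onLine_axes] <;> ring

/-! ### Comitants from the moving frame of the phase vector and its image under the linear part -/

/-- The coefficients of the system in the frame that consists of the phase vector and of its image
under the linear part, made integral by a power of the determinant of the frame. -/
def frameComitant {ℓ : ℕ} (m : Fin ℓ → ℕ) (s : Coef m) : FullRing m :=
  (frameCoord (fun ε j => X (Sum.inl ⟨s.1, ε, j⟩)) (fun ε => X (Sum.inr ε))
    (fun ε => binaryForm (fun j : Fin (degs m 0 + 1) => X (Sum.inl (⟨0, ε, j⟩ : Coef m)))
      (X (Sum.inr 0)) (X (Sum.inr 1))) s.2.1).coeff s.2.2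

lemma aeval_frameComitant {ℓ : ℕ} (m : Fin ℓ → ℕ) {A : Type*} [CommRing A] [Algebra ℝ A]
    (a : Coef m → A) (v : Fin 2 → A) (s : Coef m) :
    aeval (Sum.elim a v) (frameComitant m s) =
      (frameCoord (fun ε j => a ⟨s.1, ε, j⟩) v
        (fun ε => binaryForm (fun j : Fin (degs m 0 + 1) => a ⟨0, ε, j⟩) (v 0) (v 1))
        s.2.1).coeff s.2.2 := by
  have h := @map_binaryForm _ _ _ _ (aeval (R := ℝ) (Sum.elim a v)).toRingHom
  simp only [AlgHom.toRingHom_eq_coe, RingHom.coe_coe] at h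
  rw [frameComitant, ← RingHom.coe_coe (aeval (Sum.elim a v)), ← Polynomial.coeff_map,
    map_frameCoord]
  simp [h]

lemma eval_frameComitant {ℓ : ℕ} (m : Fin ℓ → ℕ) (a : Coef m → ℝ) (v : Fin 2 → ℝ)
    (s : Coef m) :
    eval (Sum.elim a v) (frameComitant m s) =
      (frameCoord (fun ε j => a ⟨s.1, ε, j⟩) v (part m a 0 v) s.2.1).coeff s.2.2 := by
  rw [← coe_aeval_eq_eval]
  exact aeval_frameComitant m a v s

/-- With `F` the vector form at `v + t w`, the two coordinates are `det (F, w)` and `det (v, F)`.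
All three vectors are multiplied by `q`, and `det q = 1`. -/
lemma frameCoord_mulVec {ℓ : ℕ} {m : Fin ℓ → ℕ} {q : Matrix.SpecialLinearGroup (Fin 2) ℝ}
    {a b : Coef m → ℝ} (h : Carries m q a b) (i : Fin (ℓ + 1)) (v w : Fin 2 → ℝ) (ε : Fin 2) :
    frameCoord (fun η j => b ⟨i, η, j⟩) (q.1.mulVec v) (q.1.mulVec w) ε =
      frameCoord (fun η j => a ⟨i, η, j⟩) v w ε := by
  refine Polynomial.funext fun t => ?_
  have hl : ∀ (c : Coef m → ℝ) (η : Fin 2) (v w : Fin 2 → ℝ),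
      (onLine (fun j => c ⟨i, η, j⟩) v w).eval t = part m c i (v + t • w) η := by
    intro c η v w
    simp [eval_onLine, part, mul_comm]
  have hq : q.1.mulVec v + t • q.1.mulVec w = q.1.mulVec (v + t • w) := by
    rw [Matrix.mulVec_add, Matrix.mulVec_smul]
  have hdet := q.2
  rw [Matrix.det_fin_two] at hdet
  fin_cases ε
  · simp only [frameCoord, Fin.zero_eta, Matrix.cons_val_zero, Polynomial.eval_sub,
      Polynomial.eval_mul, Polynomial.eval_C, hl]
    rw [hq, h i]
    simp only [Matrix.mulVec, dotProduct, Fin.sum_univ_two]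
    linear_combination (part m a i (v + t • w) 0 * w 1 - part m a i (v + t • w) 1 * w 0) * hdet
  · simp only [frameCoord, Fin.mk_one, Matrix.cons_val_one, Matrix.cons_val_fin_one,
      Polynomial.eval_sub, Polynomial.eval_mul, Polynomial.eval_C, hl]
    rw [hq, h i]
    simp only [Matrix.mulVec, dotProduct, Fin.sum_univ_two]
    linear_combination (part m a i (v + t • w) 1 * v 0 - part m a i (v + t • w) 0 * v 1) * hdet

lemma isComitant_frameComitant {ℓ : ℕ} (m : Fin ℓ → ℕ) (s : Coef m) :
    IsComitant m (frameComitant m s) := by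
  intro q a b h v
  -- `h 0 v` says that the second frame vector is transported by `q` as well.
  rw [eval_frameComitant, eval_frameComitant, h 0 v, frameCoord_mulVec h]

/-! ### The section `ẋ = d y + …`, `(x, y) = (1, 0)` -/

/-- The coefficient `c` of `x` in the linear part of the first equation. -/
def coefC {ℓ : ℕ} (m : Fin ℓ → ℕ) : Coef m := ⟨0, 0, 0⟩

/-- The coefficient `e` of `x` in the linear part of the second equation. -/
def coefE {ℓ : ℕ} (m : Fin ℓ → ℕ) : Coef m := ⟨0, 1, 0⟩

lemma coefE_ne_coefC {ℓ : ℕ} (m : Fin ℓ → ℕ) : coefE m ≠ coefC m := by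
  simp [coefE, coefC]

/-- The coefficients other than `c`, which parametrize the section. -/
abbrev SectionCoef {ℓ : ℕ} (m : Fin ℓ → ℕ) : Type := {s : Coef m // s ≠ coefC m}

/-- The coefficient `e`, as a coordinate of the section. -/
def sectionE {ℓ : ℕ} (m : Fin ℓ → ℕ) : SectionCoef m := ⟨coefE m, coefE_ne_coefC m⟩

open Classical in
/-- Extension of a family on the section by the value `0` for `c`. -/
def extend {ℓ : ℕ} (m : Fin ℓ → ℕ) {A : Type*} [Zero A] (z : SectionCoef m → A) (s : Coef m) : A :=
  if h : s = coefC m then 0 else z ⟨s, h⟩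

lemma extend_coefC {ℓ : ℕ} (m : Fin ℓ → ℕ) {A : Type*} [Zero A] (z : SectionCoef m → A) :
    extend m z (coefC m) = 0 := dif_pos rfl

lemma extend_coe {ℓ : ℕ} (m : Fin ℓ → ℕ) {A : Type*} [Zero A] (z : SectionCoef m → A)
    (s : SectionCoef m) : extend m z s = z s := dif_neg s.2

lemma extend_restrict {ℓ : ℕ} (m : Fin ℓ → ℕ) {A : Type*} [Zero A] (b : Coef m → A)
    (hb : b (coefC m) = 0) : extend m (fun s : SectionCoef m => b s) = b := by
  funext s
  unfold extend
  split_ifs with h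
  · rw [h, hb]
  · rfl

/-- The restriction of polynomials to the section. -/
def restrict {ℓ : ℕ} (m : Fin ℓ → ℕ) : FullRing m →ₐ[ℝ] MvPolynomial (SectionCoef m) ℝ :=
  aeval (Sum.elim (extend m X) ![1, 0])

lemma eval_restrict {ℓ : ℕ} (m : Fin ℓ → ℕ) (z : SectionCoef m → ℝ) (f : FullRing m) :
    eval z (restrict m f) = eval (Sum.elim (extend m z) ![1, 0]) f := by
  rw [← coe_aeval_eq_eval, ← coe_aeval_eq_eval, restrict]
  change ((aeval z).comp (aeval _)) f = aeval _ f
  congr 1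
  refine algHom_ext fun s => ?_
  rcases s with s | ε
  · simp only [AlgHom.comp_apply, aeval_X, Sum.elim_inl, extend]
    split_ifs <;> simp
  · fin_cases ε <;> simp

lemma restrict_frameComitant {ℓ : ℕ} (m : Fin ℓ → ℕ) (s : SectionCoef m) :
    restrict m (frameComitant m s) =
      ((degs m s.1.1).choose s.1.2.2 : MvPolynomial (SectionCoef m) ℝ) *
        X (sectionE m) ^ ((s.1.2.2 : ℕ) + (1 - (s.1.2.1 : ℕ))) * X s := by
  have hw : (fun ε => binaryForm (fun j : Fin (degs m 0 + 1) =>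
      extend m (X : _ → MvPolynomial (SectionCoef m) ℝ) ⟨0, ε, j⟩)
      ((![1, 0] : Fin 2 → MvPolynomial (SectionCoef m) ℝ) 0)
      ((![1, 0] : Fin 2 → MvPolynomial (SectionCoef m) ℝ) 1)) = ![0, X (sectionE m)] := by
    funext ε
    simp only [Matrix.cons_val_zero, Matrix.cons_val_one, Matrix.cons_val_fin_one,
      binaryForm_one_zero]
    fin_cases ε
    · exact extend_coefC m X
    · exact extend_coe m X (sectionE m)
  rw [restrict, aeval_frameComitant, hw, coeff_frameCoord_axes]
  congr 1
  exact extend_coe m X s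

lemma restrict_frameComitant_coefE {ℓ : ℕ} (m : Fin ℓ → ℕ) :
    restrict m (frameComitant m (coefE m)) = X (sectionE m) := by
  have := restrict_frameComitant m (sectionE m)
  simpa [sectionE, coefE] using this

/-- This comitant is the determinant of the frame, that is, `-k₂`. -/
lemma eval_frameComitant_coefE {ℓ : ℕ} (m : Fin ℓ → ℕ) (a : Coef m → ℝ) (v : Fin 2 → ℝ) :
    eval (Sum.elim a v) (frameComitant m (coefE m)) =
      v 0 * part m a 0 v 1 - v 1 * part m a 0 v 0 := by
  rw [eval_frameComitant]
  change (frameCoord (fun ε j => a ⟨0, ε, j⟩) v (part m a 0 v) 1).coeff 0 = _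
  simp [frameCoord, Polynomial.coeff_zero_eq_eval_zero, eval_onLine, part]

lemma eq_zero_of_restrict_eq_zero {ℓ : ℕ} {m : Fin ℓ → ℕ} {f : FullRing m}
    (hf : IsComitant m f) (h : restrict m f = 0) : f = 0 := by
  have hE : frameComitant m (coefE m) ≠ 0 := fun h0 => by
    have := restrict_frameComitant_coefE m
    rw [h0, map_zero] at this
    exact X_ne_zero _ this.symm
  -- Multiplication by the frame determinant disposes of the points where the frame degenerates.
  refine (mul_eq_zero.mp (?_ : f * frameComitant m (coefE m) = 0)).resolve_right hE
  refine MvPolynomial.funext fun u => ?_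
  obtain ⟨a, v, rfl⟩ : ∃ a v, u = Sum.elim a v :=
    ⟨u ∘ Sum.inl, u ∘ Sum.inr, (Sum.elim_comp_inl_inr u).symm⟩
  rw [map_mul, map_zero, eval_frameComitant_coefE]
  by_cases hk : v 0 * part m a 0 v 1 - v 1 * part m a 0 v 0 = 0
  · rw [hk, mul_zero]
  obtain ⟨q, hqv, hqw⟩ := exists_specialLinearGroup_mulVec v (part m a 0 v) hk
  obtain ⟨b, hb⟩ := exists_carries m q a
  -- The new linear part sends `(1, 0)` to `q w`, whose first coordinate vanishes.
  have hb0 : b (coefC m) = 0 := by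
    have := congrFun (hb 0 v) 0
    rw [hqw, hqv] at this
    simpa [part, binaryForm_one_zero, coefC] using this
  rw [← hf q a b hb v, hqv, ← extend_restrict m b hb0, ← eval_restrict, h, map_zero, zero_mul]

lemma restrict_injective {ℓ : ℕ} (m : Fin ℓ → ℕ) :
    Function.Injective ((restrict m).comp (comitants m).val) := by
  rw [injective_iff_map_eq_zero]
  exact fun f hf => Subtype.ext (eq_zero_of_restrict_eq_zero f.2 hf)

/-! ### Transcendence degree -/

/-- Multiplying the indeterminates by nonzero constants and powers of one of them, which is itself
left unchanged, preserves algebraic independence. -/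
lemma algebraicIndependent_mul_pow_mul_X {σ K : Type*} [Field K] [Infinite K] (e : σ) (c : σ → K)
    (k : σ → ℕ) (hc : ∀ s, c s ≠ 0) (hce : c e = 1) (hke : k e = 0) :
    AlgebraicIndependent K fun s => (C (c s) * X e ^ k s * X s : MvPolynomial σ K) := by
  rw [algebraicIndependent_iff]
  intro p hp
  -- It suffices to show that `p` vanishes where `t e ≠ 0`; there the substitution is inverted by
  -- `z` below, because it fixes the coordinate `e`.
  refine (mul_eq_zero.mp (?_ : p * X e = 0)).resolve_right (X_ne_zero e)
  refine MvPolynomial.funext fun t => ?_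
  rw [map_mul, eval_X, map_zero]
  by_cases ht : t e = 0
  · rw [ht, mul_zero]
  set z : σ → K := fun s => t s / (c s * t e ^ k s) with hz
  have hze : z e = t e := by simp [hz, hce, hke]
  have h := congrArg (eval z) hp
  rw [map_zero, ← coe_aeval_eq_eval, RingHom.coe_coe, ← AlgHom.comp_apply, comp_aeval] at h
  have ht' : (fun s => aeval z (C (c s) * X e ^ k s * X s : MvPolynomial σ K)) = t := by
    funext s
    have h1 : c s * t e ^ k s ≠ 0 := mul_ne_zero (hc s) (pow_ne_zero _ ht)
    simp only [map_mul, map_pow, aeval_X, algHom_C, Algebra.algebraMap_self, RingHom.id_apply, hze]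
    exact mul_div_cancel₀ _ h1
  rw [ht'] at h
  rw [← coe_aeval_eq_eval, RingHom.coe_coe, h, zero_mul]

lemma algebraicIndependent_frameComitant {ℓ : ℕ} (m : Fin ℓ → ℕ) :
    AlgebraicIndependent ℝ fun s : SectionCoef m =>
      (⟨frameComitant m s, isComitant_frameComitant m s⟩ : comitants m) := by
  refine AlgebraicIndependent.of_comp ((restrict m).comp (comitants m).val) ?_
  have h := algebraicIndependent_mul_pow_mul_X (K := ℝ) (sectionE m)
    (fun s => ((degs m s.1.1).choose s.1.2.2 : ℝ))
    (fun s => (s.1.2.2 : ℕ) + (1 - (s.1.2.1 : ℕ)))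
    (fun s => Nat.cast_ne_zero.mpr (Nat.choose_pos (Nat.lt_succ_iff.mp s.1.2.2.2)).ne')
    (by simp [sectionE, coefE]) (by simp [sectionE, coefE])
  have he : (restrict m).comp (comitants m).val ∘ (fun s : SectionCoef m =>
      (⟨frameComitant m s, isComitant_frameComitant m s⟩ : comitants m)) = fun s =>
      C ((degs m s.1.1).choose s.1.2.2 : ℝ) *
        X (sectionE m) ^ ((s.1.2.2 : ℕ) + (1 - (s.1.2.1 : ℕ))) * X s := by
    funext s
    simpa using restrict_frameComitant m s
  rw [he]
  exact h

lemma card_sectionCoef {ℓ : ℕ} (m : Fin ℓ → ℕ) :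
    Fintype.card (SectionCoef m) = 2 * (∑ i, m i + ℓ) + 3 := by
  classical
  rw [Fintype.card_subtype_compl, Fintype.card_subtype_eq]
  have h : Fintype.card (Coef m) = ∑ i, 2 * (degs m i + 1) := by simp
  rw [h, Fin.sum_univ_succ]
  simp only [degs, Fin.cons_zero, Fin.cons_succ, ← Finset.mul_sum, Finset.sum_add_distrib,
    Finset.sum_const, Finset.card_univ, Fintype.card_fin, smul_eq_mul, mul_one]
  omega

lemma trdeg_comitants {ℓ : ℕ} (m : Fin ℓ → ℕ) :
    Algebra.trdeg ℝ (comitants m) = ((2 * (∑ i, m i + ℓ) + 3 : ℕ) : Cardinal) := by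
  rw [← card_sectionCoef, ← Cardinal.mk_fintype]
  refine le_antisymm ?_ (algebraicIndependent_frameComitant m).cardinalMk_le_trdeg
  simpa using trdeg_le_of_injective _ (restrict_injective m)

/-! ### The generalized focal pseudo-quantities -/

lemma comitantsFor_le {ℓ : ℕ} (m : Fin ℓ → ℕ) (k : ℕ) :
    comitantsFor m k ≤ Subalgebra.toSubmodule (comitants m) :=
  iSup_le fun _ => inf_le_left

lemma comitants'_le {ℓ : ℕ} (m : Fin ℓ → ℕ) : comitants' m ≤ comitants m := by
  refine Algebra.adjoin_le (Set.union_subset (fun f hf => hf.1) ?_)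
  exact Set.iUnion₂_subset fun k _ => comitantsFor_le m k

lemma part_zero_apply {ℓ : ℕ} (m : Fin ℓ → ℕ) (a : Coef m → ℝ) (v : Fin 2 → ℝ) (ε : Fin 2) :
    part m a 0 v ε = a ⟨0, ε, (0 : Fin (1 + 1))⟩ * v 0 + a ⟨0, ε, (1 : Fin (1 + 1))⟩ * v 1 := by
  change binaryForm (n := 1) (fun j => a ⟨0, ε, j⟩) (v 0) (v 1) = _
  simp [binaryForm, Fin.sum_univ_two]

/-- The polynomial `i₁` is the trace of the linear part, hence an invariant of the system. -/
lemma isComitant_rename_i1 {ℓ : ℕ} (m : Fin ℓ → ℕ) :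
    IsComitant m (rename Sum.inl (i1 m)) := by
  intro q a b h v
  have hdet := q.2
  rw [Matrix.det_fin_two] at hdet
  have e1 := fun ε => congrFun (h 0 ![1, 0]) ε
  have e2 := fun ε => congrFun (h 0 ![0, 1]) ε
  simp only [part_zero_apply, Matrix.mulVec, dotProduct, Fin.sum_univ_two, Matrix.cons_val_zero,
    Matrix.cons_val_one, Matrix.cons_val_fin_one, mul_one, mul_zero, add_zero, zero_add] at e1 e2
  have h1 := e1 0
  have h2 := e1 1
  have h3 := e2 0
  have h4 := e2 1
  simp only [i1, lin, map_add, rename_X, eval_X, Sum.elim_inl]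
  -- With `A`, `B` the old and new linear parts, this is the trace of `B q = q A` multiplied on the
  -- right by the adjugate of `q`; the last term replaces `det q` by 1.
  linear_combination q.1 1 1 * h1 - q.1 0 1 * h2 - q.1 1 0 * h3 + q.1 0 0 * h4 +
    (a ⟨0, 0, (0 : Fin (1 + 1))⟩ + a ⟨0, 1, (1 : Fin (1 + 1))⟩ - b ⟨0, 0, (0 : Fin (1 + 1))⟩
      - b ⟨0, 1, (1 : Fin (1 + 1))⟩) * hdet

lemma IsPseudoQuantity.exists_comitant {ℓ : ℕ} {m : Fin ℓ → ℕ} {S : CoefRing m}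
    (hS : IsPseudoQuantity m S) : ∃ f : comitants m, semiInvariant m f = S := by
  rcases hS with rfl | ⟨k, -, -, -, -, f, hf, rfl⟩
  · refine ⟨⟨_, isComitant_rename_i1 m⟩, ?_⟩
    simp [semiInvariant, i1, lin]
  · exact ⟨⟨f, comitantsFor_le m k hf⟩, rfl⟩

/-- A relation among the chosen comitants would persist among their semi-invariants. -/
lemma card_le_of_algebraicIndependent {ℓ n : ℕ} {m : Fin ℓ → ℕ} {S : Fin n → CoefRing m}
    (hS : ∀ i, IsPseudoQuantity m (S i)) (hind : AlgebraicIndependent ℝ S) :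
    n ≤ 2 * (∑ i, m i + ℓ) + 3 := by
  choose f hf using fun i => (hS i).exists_comitant
  have hf' : (semiInvariant m).comp (comitants m).val ∘ f = S := funext hf
  have h := (AlgebraicIndependent.of_comp _ (hf' ▸ hind)).cardinalMk_le_trdeg
  rw [trdeg_comitants, Cardinal.mk_fin] at h
  exact_mod_cast h

end FocalPseudo

end

theorem lemma2 (ℓ : ℕ) (m : Fin ℓ → ℕ) (hm : ∀ i, 1 ≤ m i)
    (hdistinct : Function.Injective (FocalPseudo.degs m)) :
    FocalPseudo.comitants' m ≤ FocalPseudo.comitants m ∧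
    Algebra.trdeg ℝ (FocalPseudo.comitants m) = ((2 * (∑ i, m i + ℓ) + 3 : ℕ) : Cardinal) ∧
    ∀ (n : ℕ) (S : Fin n → FocalPseudo.CoefRing m),
      (∀ i, FocalPseudo.IsPseudoQuantity m (S i)) →
      AlgebraicIndependent ℝ S →
      n ≤ 2 * (∑ i, m i + ℓ) + 3 := by
  exact ⟨FocalPseudo.comitants'_le m, FocalPseudo.trdeg_comitants m,
    fun _ _ => FocalPseudo.card_le_of_algebraicIndependent⟩
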